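/- Let $\mathbb{F}$ be an infinite field, let $d\ge 0$, and let $\Delta$ be a finite simplicial complex that is pure of dimension $d-1$ (all inclusion-maximal faces have exactly $d$ vertices). For a finite simplicial complex $\Gamma$ of dimension $e-1$ with vertex set $W$, let $\mathbb{F}[\Gamma]=\mathbb{F}[x_w : w\in W]/I_\Gamma$ be its face (Stanley--Reisner) ring, where $I_\Gamma$ is generated by the monomials $\prod_{w\in S}x_w$ with $S\subseteq W$ not a face of $\Gamma$. One-forms $\theta_1,\dots,\theta_e$ are a linear system of parameters (l.s.o.p.) if $\mathbb{F}(\Gamma)=\mathbb{F}[\Gamma]/(\theta_1,\dots,\theta_e)$ is finite-dimensional over $\mathbb{F}$; $\mathbb{F}(\Gamma)_j$ denotes the degree-$j$ component of this graded ring (zero for $j<0$). A property holds for generic $\Theta=(\theta_1,\dots,\theta_e)$ and $\omega$ if it holds for all coefficient matrices of $(\theta_1,\dots,\theta_e,\omega)$ in some nonempty Zariski open subset of $\mathbb{F}^{(e+1)|W|}$. Let $i\ge 0$ be an integer, and let $V$ be the set of vertices $v$ of $\Delta$ for which the following fails: for generic $\Theta_v=(\theta_1,\dots,\theta_{d-1})$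 and $\omega_v$, $\Theta_v$ is an l.s.o.p. for the face ring of the link $\mathrm{lk}\,v$ and multiplication $\cdot\omega_v:\mathbb{F}(\mathrm{lk}\,v)_{i-1}\to\mathbb{F}(\mathrm{lk}\,v)_i$ is surjective. Then, for generic $\Theta=(\theta_1,\dots,\theta_d)$ and $\omega$, $\Theta$ is an l.s.o.p. for $\mathbb{F}[\Delta]$ and the cokernel of multiplication $\cdot\omega:\mathbb{F}(\Delta)_i\to\mathbb{F}(\Delta)_{i+1}$ has dimension at most the number of monomials of degree $i+1$ in $\max(|V|-d-1,\,0)$ variables. -/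

import Mathlib

/-- A subset of affine space `F^ι` is Zariski open if it is the complement of the common zero
locus of an ideal of polynomials. -/
def IsZariskiOpen {F ι : Type*} [Field F] (U : Set (ι → F)) : Prop :=
  ∃ I : Ideal (MvPolynomial ι F), U = (MvPolynomial.zeroLocus F I)ᶜ

/-- A property holds for generic points of `F^ι` if it holds at all points of some nonempty
Zariski open subset. -/
def Generically {F ι : Type*} [Field F] (P : (ι → F) → Prop) : Prop :=
  ∃ U : Set (ι → F), IsZariskiOpen U ∧ U.Nonempty ∧ ∀ a ∈ U, P a

/-- The one-form `∑ v, a v * x_v`. -/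
noncomputable def oneForm {F σ : Type*} [Field F] [Fintype σ] (a : σ → F) : MvPolynomial σ F :=
  ∑ v, MvPolynomial.C (a v) * MvPolynomial.X v

theorem oneForm_isHomogeneous {F σ : Type*} [Field F] [Fintype σ] (a : σ → F) :
    (oneForm a).IsHomogeneous 1 :=
  MvPolynomial.IsHomogeneous.sum _ _ _ fun v _ => by
    simpa using (MvPolynomial.isHomogeneous_C σ (a v)).mul (MvPolynomial.isHomogeneous_X F v)

/-- The number of monomials of degree `k` in a polynomial ring with `m` variables. -/
noncomputable def numMonomials (m k : ℕ) : ℕ :=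
  Nat.card {s : Fin m →₀ ℕ // s.degree = k}

/- Mathlib's `PreAbstractSimplicialComplex α` records the nonempty faces of a simplicial complex
whose vertices lie in `α` (not every element of `α` has to be a vertex). The empty set is always
understood to be a face, so that `⊥` is the complex `{∅}`, of dimension `-1`. -/
namespace PreAbstractSimplicialComplex

/-- The vertices of `K`. -/
def Vertex {α : Type*} (K : PreAbstractSimplicialComplex α) : Type _ :=
  {v : α // {v} ∈ K}

noncomputable instance {α : Type*} [Finite α] (K : PreAbstractSimplicialComplex α) :
    Fintype K.Vertex :=
  haveI : Finite K.Vertex := inferInstanceAs (Finite {v : α // {v} ∈ K})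
  Fintype.ofFinite _

/-- `K` is pure of dimension `d - 1`: every inclusion-maximal face has exactly `d` vertices.
The second clause says that `{∅}` is not of this kind when `d ≠ 0`. -/
def IsPure {α : Type*} (K : PreAbstractSimplicialComplex α) (d : ℕ) : Prop :=
  (∀ s : Finset α, Maximal (fun t => t ∈ K) s → s.card = d) ∧ (d ≠ 0 → ∃ s : Finset α, s ∈ K)

/-- The link of `v`: the faces `t` with `v ∉ t` and `{v} ∪ t` a face. -/
def link {α : Type*} (K : PreAbstractSimplicialComplex α) (v : α) :
    PreAbstractSimplicialComplex α where
  faces := {t | t.Nonempty ∧ ∃ h : v ∉ t, t.cons v h ∈ K}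
  isRelLowerSet_faces := by
    rintro t ⟨hne, hv, ht⟩
    refine ⟨hne, fun s hst hs => ⟨hs, fun h => hv (hst h), ?_⟩⟩
    exact (K.isRelLowerSet_faces ht).2 (Finset.cons_subset_cons.2 hst)
      (Finset.cons_nonempty _)

section FaceRing

variable {α F : Type*} [Field F]

/-- The face ideal of `K` in the polynomial ring with one variable for each vertex, generated by
the squarefree monomials of the nonfaces. -/
noncomputable def faceIdeal (F : Type*) [Field F] (K : PreAbstractSimplicialComplex α) :
    Ideal (MvPolynomial K.Vertex F) :=
  Ideal.span {p | ∃ s : Finset K.Vertex, s.Nonempty ∧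
    s.map ⟨Subtype.val, Subtype.val_injective⟩ ∉ K ∧ p = ∏ v ∈ s, MvPolynomial.X v}

variable [Finite α]

/-- The ring `F(K) = F[K]/Θ`, where `F[K]` is the face ring and `Θ` is generated by the one-forms
with coefficient vectors `θ 0, …, θ (d - 1)`; it is presented as a single quotient of the
polynomial ring. -/
abbrev ReducedFaceRing (K : PreAbstractSimplicialComplex α) {d : ℕ}
    (θ : Fin d → K.Vertex → F) : Type _ :=
  MvPolynomial K.Vertex F ⧸ (K.faceIdeal F ⊔ Ideal.span (Set.range fun k => oneForm (θ k)))

/-- The one-forms with coefficient vectors `θ 0, …, θ (d - 1)` are a linear system of parameters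
for the face ring of `K` (where `d - 1` is the dimension of `K`). -/
def IsLSOP (K : PreAbstractSimplicialComplex α) {d : ℕ} (θ : Fin d → K.Vertex → F) : Prop :=
  Module.Finite F (K.ReducedFaceRing θ)

/-- The component `F(K)_j` of degree `j`, which is zero for negative `j`. -/
noncomputable def component (K : PreAbstractSimplicialComplex α) {d : ℕ}
    (θ : Fin d → K.Vertex → F) : ℤ → Submodule F (K.ReducedFaceRing θ)
  | Int.ofNat n => (MvPolynomial.homogeneousSubmodule K.Vertex F n).map
      (Ideal.Quotient.mkₐ F
        (K.faceIdeal F ⊔ Ideal.span (Set.range fun k => oneForm (θ k)))).toLinearMap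
  | Int.negSucc _ => ⊥

theorem mul_mem_component (K : PreAbstractSimplicialComplex α) {d : ℕ}
    (θ : Fin d → K.Vertex → F) (w : K.Vertex → F) (j : ℤ) :
    ∀ x ∈ K.component θ j,
      LinearMap.mulLeft F (Ideal.Quotient.mk _ (oneForm w) : K.ReducedFaceRing θ) x ∈
        K.component θ (j + 1) := by
  intro x hx
  cases j with
  | ofNat n =>
    obtain ⟨p, hp, rfl⟩ := hx
    refine ⟨oneForm w * p, ?_, by simp⟩
    have h := (oneForm_isHomogeneous w).mul ((MvPolynomial.mem_homogeneousSubmodule n p).1 hp)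
    rw [add_comm] at h
    exact (MvPolynomial.mem_homogeneousSubmodule (n + 1) _).2 h
  | negSucc n =>
    have h0 : x = 0 := (Submodule.mem_bot F).1 hx
    rw [h0, map_zero]
    exact Submodule.zero_mem _

/-- Multiplication by the one-form with coefficient vector `w`, from degree `j` to `j + 1`. -/
noncomputable def mulOneForm (K : PreAbstractSimplicialComplex α) {d : ℕ}
    (θ : Fin d → K.Vertex → F) (w : K.Vertex → F) (j : ℤ) :
    K.component θ j →ₗ[F] K.component θ (j + 1) :=
  (LinearMap.mulLeft F (Ideal.Quotient.mk _ (oneForm w) : K.ReducedFaceRing θ)).restrict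
    (K.mul_mem_component θ w j)

/-- For generic one-forms `θ_1, …, θ_d, ω` (a generic point of the affine space of all coefficient
matrices with `d + 1` rows, the last row being `ω`), the `θ_k` are a linear system of parameters
for the face ring of `K` and `P Θ ω` holds. -/
def ForGenericForms (F : Type*) [Field F] (K : PreAbstractSimplicialComplex α) (d : ℕ)
    (P : (Fin d → K.Vertex → F) → (K.Vertex → F) → Prop) : Prop :=
  Generically fun A : Fin (d + 1) × K.Vertex → F =>
    K.IsLSOP (fun (k : Fin d) v => A (k.castSucc, v)) ∧
      P (fun (k : Fin d) v => A (k.castSucc, v)) (fun v => A (Fin.last d, v))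

/-- For `K` of dimension `d - 1`, the set of vertices `v` for which it is not true that
multiplication `F(lk v)_{i-1} → F(lk v)_i` is surjective for generic linear systems of parameters
and one-forms of the link (which has dimension `d - 2`). -/
def badVertices (F : Type*) [Field F] (K : PreAbstractSimplicialComplex α) (d : ℕ) (i : ℤ) :
    Set K.Vertex :=
  {v | ¬ (K.link v.1).ForGenericForms F (d - 1) fun θ w =>
    Function.Surjective ((K.link v.1).mulOneForm θ w (i - 1))}

end FaceRing

end PreAbstractSimplicialComplex

/-!
Write `R` for the polynomial ring on the vertices of `K` and `J` (`lefschetzIdeal`) for the ideal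
generated by the face ideal, the forms `θ_k` and `ω`. The cokernel of multiplication by `ω` is the
degree `i + 1` part of `R / J`, since all these ideals are homogeneous.

*Good vertices die in the cokernel.* Let `v` be a vertex whose link has the surjectivity property.
In `F[K]` the multiples of `x_v` only see the star of `v`, whose face ring is that of the link with
one more variable `x_v`. If the coefficient of `x_v` in `θ_1` is nonzero, `θ_1` eliminates `x_v`, and
the remaining forms together with `ω` become forms on the link (`linkForms`). Generic forms on `K`
give generic forms on the link in this way (`generically_linkForms`), so that surjectivity on the
link says that `x_v` multiplies all of `R_i` into `J` (`X_mul_mem_lefschetzIdeal`). This is an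
argument about the ideal of all `q` with `x_v q ∈ J`.

*Counting.* Hence, in degree `i + 1`, one may add the good variables to `J`. The `d + 1` generic
forms `θ_1, …, θ_d, ω` eliminate `min (d + 1) (#V)` of the remaining variables
(`generically_exists_eliminate`), and the cokernel is spanned by the monomials of degree `i + 1` in
the variables that are left (`rank_coker_le_of_X_mem`).

*Systems of parameters.* The forms are a linear system of parameters as soon as their restrictions
to all facets are invertible (`isLSOP_of_det_ne_zero`), which is a finite number of generic
conditions as all facets have `d` vertices.

Finitely many generic conditions hold simultaneously because affine space over an infinite field is
irreducible (`Generically.forall_of_finite`).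
-/

open MvPolynomial

/-! ### Generic properties -/

section Generic

variable {F ι κ : Type*} [Field F]

theorem Generically.mono {P Q : (ι → F) → Prop} (hP : Generically P) (h : ∀ a, P a → Q a) :
    Generically Q := by
  obtain ⟨U, hU, hne, hUP⟩ := hP
  exact ⟨U, hU, hne, fun a ha => h a (hUP a ha)⟩

theorem generically_of_eval_ne_zero {P : (ι → F) → Prop} (f : MvPolynomial ι F)
    (hne : ∃ a, eval a f ≠ 0) (h : ∀ a, eval a f ≠ 0 → P a) : Generically P := by
  have key : ∀ a, a ∈ (zeroLocus F (Ideal.span {f}))ᶜ ↔ eval a f ≠ 0 := by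
    intro a
    rw [zeroLocus_span]
    simp [aeval_eq_eval]
  refine ⟨_, ⟨Ideal.span {f}, rfl⟩, ?_, fun a ha => h a ((key a).1 ha)⟩
  obtain ⟨a, ha⟩ := hne
  exact ⟨a, (key a).2 ha⟩

/-- Every nonempty Zariski open set contains a nonempty basic open set. -/
theorem Generically.exists_eval_ne_zero {P : (ι → F) → Prop} (hP : Generically P) :
    ∃ f : MvPolynomial ι F, (∃ a, eval a f ≠ 0) ∧ ∀ a, eval a f ≠ 0 → P a := by
  obtain ⟨_, ⟨I, rfl⟩, ⟨a, ha⟩, hUP⟩ := hP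
  simp only [Set.mem_compl_iff, mem_zeroLocus_iff, not_forall, aeval_eq_eval] at ha hUP
  obtain ⟨f, hf, hfa⟩ := ha
  exact ⟨f, ⟨a, hfa⟩, fun b hb => hUP b ⟨f, hf, hb⟩⟩

/-- Over an infinite field affine space is irreducible, so finitely many generic properties hold
generically at the same time. -/
theorem Generically.forall_of_finite [Infinite F] [Finite κ] {P : κ → (ι → F) → Prop}
    (h : ∀ j, Generically (P j)) : Generically fun a => ∀ j, P j a := by
  cases nonempty_fintype κ
  choose f hne hf using fun j => (h j).exists_eval_ne_zero
  have hprod : ∏ j, f j ≠ 0 := by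
    refine Finset.prod_ne_zero_iff.2 fun j _ h0 => ?_
    obtain ⟨a, ha⟩ := hne j
    exact ha (by rw [h0, map_zero])
  refine generically_of_eval_ne_zero (∏ j, f j) ?_ fun a ha j => hf j a ?_
  · by_contra! hall
    exact hprod (MvPolynomial.funext fun a => by rw [hall a, map_zero])
  · rw [map_prod] at ha
    exact Finset.prod_ne_zero_iff.1 ha j (Finset.mem_univ j)

theorem Generically.and [Infinite F] {P Q : (ι → F) → Prop} (hP : Generically P)
    (hQ : Generically Q) : Generically fun a => P a ∧ Q a := by
  have h : Generically fun a => ∀ b : Bool, cond b (P a) (Q a) :=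
    Generically.forall_of_finite fun b => by cases b <;> assumption
  exact h.mono fun a ha => ⟨ha true, ha false⟩

/-- A generic property can be pulled back along a surjective polynomial map. -/
theorem Generically.comp_eval {P : (κ → F) → Prop} (hP : Generically P)
    (g : κ → MvPolynomial ι F) (hg : ∀ b : κ → F, ∃ a, ∀ j, eval a (g j) = b j) :
    Generically fun a => P fun j => eval a (g j) := by
  obtain ⟨f, ⟨b, hb⟩, hf⟩ := hP.exists_eval_ne_zero
  have key : ∀ a, eval a (bind₁ g f) = eval (fun j => eval a (g j)) f := by
    intro a
    rw [← aeval_eq_eval, ← aeval_eq_eval]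
    simp only [aeval_bind₁, aeval_eq_eval]
  refine generically_of_eval_ne_zero (bind₁ g f) ?_ fun a ha => hf _ (by rwa [← key])
  obtain ⟨a, ha⟩ := hg b
  exact ⟨a, by rwa [key, _root_.funext ha]⟩

/-- A given minor of a generic matrix does not vanish. -/
theorem generically_det_ne_zero {ρ n : Type*} [Fintype n] [DecidableEq n] {f : n → ρ} {g : n → κ}
    (hf : f.Injective) (hg : g.Injective) :
    Generically fun A : ρ × κ → F => (Matrix.of fun i j => A (f i, g j)).det ≠ 0 := by
  classical
  have key : ∀ A : ρ × κ → F, eval A (Matrix.of fun i j =>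
      (X (f i, g j) : MvPolynomial (ρ × κ) F)).det = (Matrix.of fun i j => A (f i, g j)).det := by
    intro A
    rw [RingHom.map_det]
    congr 1
    ext i j
    simp
  refine generically_of_eval_ne_zero _
    ⟨fun p => if ∃ i, p = (f i, g i) then 1 else 0, ?_⟩ fun A hA => by rwa [key] at hA
  rw [key]
  convert one_ne_zero (α := F)
  convert Matrix.det_one (n := n) (R := F)
  ext i j
  have : (∃ k, f i = f k ∧ g j = g k) ↔ i = j :=
    ⟨fun ⟨k, h1, h2⟩ => (hf h1).trans (hg h2).symm, fun h => ⟨i, rfl, by rw [h]⟩⟩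
  simp [Matrix.one_apply, this]

end Generic

/-! ### Linear algebra of one-forms -/

section LinearAlgebra

variable {F : Type*} [Field F]

/-- An invertible system of linear equations modulo a submodule has only the trivial solution. -/
theorem Submodule.mem_of_det_ne_zero {n E : Type*} [Fintype n] [DecidableEq n] [AddCommGroup E]
    [Module F E] (N : Submodule F E) {M : Matrix n n F} (hM : M.det ≠ 0) {x : n → E}
    (h : ∀ i, ∑ j, M i j • x j ∈ N) (j : n) : x j ∈ N := by
  have hinv : M⁻¹ * M = 1 := Matrix.nonsing_inv_mul M (Ne.isUnit hM)
  have : x j = ∑ i, M⁻¹ j i • ∑ k, M i k • x k := by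
    simp_rw [Finset.smul_sum, smul_smul]
    rw [Finset.sum_comm]
    simp_rw [← Finset.sum_smul, ← Matrix.mul_apply, hinv, Matrix.one_apply]
    simp
  rw [this]
  exact N.sum_mem fun i _ => N.smul_mem _ (h i)

theorem oneForm_eq_sum_add_sum {σ n : Type*} [Fintype σ] [DecidableEq σ] [Fintype n]
    {g : n → σ} (hg : g.Injective) (a : σ → F) [DecidablePred (· ∉ Set.range g)] :
    oneForm a = ∑ j, a (g j) • X (g j) +
      ∑ u ∈ Finset.univ.filter (· ∉ Set.range g), a u • (X u : MvPolynomial σ F) := by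
  classical
  simp_rw [smul_eq_C_mul]
  rw [oneForm, ← Finset.sum_filter_add_sum_filter_not _ (· ∈ Set.range g),
    ← Finset.sum_image (f := fun u => C (a u) * X u) (g := g) hg.injOn]
  congr 1
  exact Finset.sum_congr (by ext; simp) fun _ _ => rfl

theorem rank_homogeneousSubmodule_fin (m k : ℕ) :
    Module.rank F (homogeneousSubmodule (Fin m) F k) = (numMonomials m k : ℕ) := by
  have : Finite {s : Fin m →₀ ℕ // s.degree = k} :=
    (Finsupp.finite_of_degree_le (σ := Fin m) k).subset fun s hs => le_of_eq hs
  rw [homogeneousSubmodule_eq_finsupp_supported,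
    (AddMonoidAlgebra.supportedEquivFinsupp _).rank_eq, rank_finsupp_self, numMonomials,
    ← Cardinal.lift_natCast.{_, 0}, Nat.cast_card]
  rfl

end LinearAlgebra

/-! ### Homogeneous components -/

section Graded

variable {F σ : Type*} [Field F]

attribute [local instance] MvPolynomial.gradedAlgebra

theorem homogeneousComponent_succ_mul {l : MvPolynomial σ F} (hl : l.IsHomogeneous 1)
    (a : MvPolynomial σ F) (n : ℕ) :
    homogeneousComponent (n + 1) (a * l) = homogeneousComponent n a * l := by
  have := DirectSum.coe_decompose_mul_add_of_right_mem (homogeneousSubmodule σ F) (a := a) (b := l)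
    (i := n) (j := 1) hl
  have h : ∀ (p : MvPolynomial σ F) k,
    (DirectSum.decompose (homogeneousSubmodule σ F) p k : MvPolynomial σ F) =
      homogeneousComponent k p := decomposition.decompose'_apply
  rwa [h, h] at this

end Graded

/-! ### The ideals presenting `F(K)` and its quotient by a one-form -/

namespace PreAbstractSimplicialComplex

variable {α F : Type*} [Field F] (K : PreAbstractSimplicialComplex α)

variable {K} in
theorem singleton_mem_of_mem {s : Finset α} (hs : s ∈ K) {u : α} (hu : u ∈ s) : {u} ∈ K :=
  (K.isRelLowerSet_faces hs).2 (Finset.singleton_subset_iff.2 hu) (Finset.singleton_nonempty u)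

/-- The inclusion of the vertices of `K` into the ambient type. -/
def vertexEmb : K.Vertex ↪ α := ⟨Subtype.val, Subtype.val_injective⟩

theorem prod_X_mem_faceIdeal {s : Finset K.Vertex} (hs : s.Nonempty)
    (h : s.map K.vertexEmb ∉ K) :
    ∏ v ∈ s, X v ∈ K.faceIdeal F :=
  Ideal.subset_span ⟨s, hs, h, rfl⟩

theorem X_mul_X_mem_faceIdeal [DecidableEq α] {u v : K.Vertex} (huv : u ≠ v)
    (h : ({u.1, v.1} : Finset α) ∉ K) : X u * X v ∈ K.faceIdeal F := by
  classical
  rw [← Finset.prod_pair huv]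
  refine K.prod_X_mem_faceIdeal ⟨u, by simp⟩ ?_
  convert h
  rw [Finset.map_insert, Finset.map_singleton]
  rfl

variable [Finite α] {d : ℕ} (θ : Fin d → K.Vertex → F) (w : K.Vertex → F)

/-- The ideal presenting `F(K)`. -/
noncomputable def reducedIdeal : Ideal (MvPolynomial K.Vertex F) :=
  K.faceIdeal F ⊔ Ideal.span (Set.range fun k => oneForm (θ k))

/-- The ideal presenting the quotient of `F(K)` by the one-form with coefficient vector `w`. -/
noncomputable def lefschetzIdeal : Ideal (MvPolynomial K.Vertex F) :=
  K.reducedIdeal θ ⊔ Ideal.span {oneForm w}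

variable {K θ w}

theorem faceIdeal_le_lefschetzIdeal : K.faceIdeal F ≤ K.lefschetzIdeal θ w :=
  le_sup_left.trans le_sup_left

theorem oneForm_mem_reducedIdeal (k : Fin d) : oneForm (θ k) ∈ K.reducedIdeal θ :=
  Ideal.mem_sup_right (Ideal.subset_span ⟨k, rfl⟩)

theorem oneForm_mem_lefschetzIdeal (k : Fin d) : oneForm (θ k) ∈ K.lefschetzIdeal θ w :=
  Ideal.mem_sup_left (oneForm_mem_reducedIdeal k)

theorem oneForm_self_mem_lefschetzIdeal : oneForm w ∈ K.lefschetzIdeal θ w :=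
  Ideal.mem_sup_right (Ideal.mem_span_singleton_self _)

section Graded

attribute [local instance] MvPolynomial.gradedAlgebra

theorem isHomogeneous_reducedIdeal :
    (K.reducedIdeal θ).IsHomogeneous (homogeneousSubmodule K.Vertex F) := by
  refine .sup (Ideal.homogeneous_span _ _ ?_) (Ideal.homogeneous_span _ _ ?_)
  · rintro _ ⟨s, -, -, rfl⟩
    exact ⟨_, IsHomogeneous.prod s _ (fun _ => 1) fun v _ => isHomogeneous_X F v⟩
  · rintro _ ⟨k, rfl⟩
    exact ⟨1, oneForm_isHomogeneous _⟩

theorem isHomogeneous_lefschetzIdeal :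
    (K.lefschetzIdeal θ w).IsHomogeneous (homogeneousSubmodule K.Vertex F) := by
  refine .sup isHomogeneous_reducedIdeal (Ideal.homogeneous_span _ _ ?_)
  rintro _ rfl
  exact ⟨1, oneForm_isHomogeneous _⟩

theorem exists_sub_mul_oneForm_mem {n : ℕ} {p : MvPolynomial K.Vertex F}
    (hp : p.IsHomogeneous (n + 1)) (h : p ∈ K.lefschetzIdeal θ w) :
    ∃ q : MvPolynomial K.Vertex F, q.IsHomogeneous n ∧ p - oneForm w * q ∈ K.reducedIdeal θ := by
  obtain ⟨y, hy, z, hz, rfl⟩ := Submodule.mem_sup.1 h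
  obtain ⟨a, rfl⟩ := Ideal.mem_span_singleton'.1 hz
  refine ⟨homogeneousComponent n a, homogeneousComponent_isHomogeneous _ _, ?_⟩
  have h1 := homogeneousComponent_mem_of_mem isHomogeneous_reducedIdeal hy (n + 1)
  rw [← homogeneousComponent_eq_self hp, map_add,
    homogeneousComponent_succ_mul (oneForm_isHomogeneous w)]
  convert h1 using 1
  ring

/-- If the variables `x_v` with `v ∈ S` multiply all forms of degree `n` into the homogeneous
ideal `lefschetzIdeal`, then adding them to the ideal does not change it in degree `n + 1`. -/
theorem mem_lefschetzIdeal_of_mem_sup {S : Set K.Vertex} {n : ℕ}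
    (hS : ∀ v ∈ S, ∀ q : MvPolynomial K.Vertex F, q.IsHomogeneous n →
      X v * q ∈ K.lefschetzIdeal θ w)
    {p : MvPolynomial K.Vertex F} (hp : p.IsHomogeneous (n + 1))
    (h : p ∈ K.lefschetzIdeal θ w ⊔ Ideal.span (X '' S)) : p ∈ K.lefschetzIdeal θ w := by
  obtain ⟨y, hy, z, hz, rfl⟩ := Submodule.mem_sup.1 h
  rw [← homogeneousComponent_eq_self hp, map_add]
  refine add_mem (homogeneousComponent_mem_of_mem isHomogeneous_lefschetzIdeal hy _) ?_
  obtain ⟨N, f, g, rfl⟩ := Submodule.mem_span_set'.1 hz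
  rw [map_sum]
  refine sum_mem fun k _ => ?_
  obtain ⟨v, hv, hvk⟩ := (g k).2
  rw [← hvk, smul_eq_mul, homogeneousComponent_succ_mul (isHomogeneous_X F v), mul_comm]
  exact hS v hv _ (homogeneousComponent_isHomogeneous _ _)

end Graded

/-- For `i = 0` the hypothesis says that the degree `0` part of `F(K)` is zero, because its part of
degree `-1` is. -/
theorem mem_lefschetzIdeal_of_surjective {i : ℕ}
    (h : Function.Surjective (K.mulOneForm θ w ((i : ℤ) - 1))) {p : MvPolynomial K.Vertex F}
    (hp : p.IsHomogeneous i) : p ∈ K.lefschetzIdeal θ w := by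
  have hmem : (Ideal.Quotient.mk _ p : K.ReducedFaceRing θ) ∈
      K.component θ ((i : ℤ) - 1 + 1) := by
    rw [sub_add_cancel]
    exact ⟨p, hp, rfl⟩
  obtain ⟨⟨x, hx⟩, hxy⟩ := h ⟨_, hmem⟩
  obtain ⟨q, rfl⟩ := Ideal.Quotient.mk_surjective x
  have hxy' : (Ideal.Quotient.mk _ (oneForm w) : K.ReducedFaceRing θ) * Ideal.Quotient.mk _ q =
    Ideal.Quotient.mk _ p := congrArg Subtype.val hxy
  rw [← map_mul, eq_comm, Ideal.Quotient.eq] at hxy'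
  rw [← sub_add_cancel p (oneForm w * q)]
  exact add_mem (Ideal.mem_sup_left hxy')
    (Ideal.mul_mem_right _ _ oneForm_self_mem_lefschetzIdeal)

/-- If modulo `lefschetzIdeal` every form of degree `i + 1` can be written in the `m` variables
`x_{b j}`, then the cokernel of `F(K)_i → F(K)_{i+1}` is spanned by their monomials. -/
theorem rank_coker_le {i m : ℕ} (b : Fin m → K.Vertex)
    (h : ∀ p : MvPolynomial K.Vertex F, p.IsHomogeneous (i + 1) →
      ∃ r : MvPolynomial (Fin m) F, r.IsHomogeneous (i + 1) ∧
        p - rename b r ∈ K.lefschetzIdeal θ w) :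
    Module.rank F (K.component θ (i + 1) ⧸ LinearMap.range (K.mulOneForm θ w i)) ≤
      (numMonomials m (i + 1) : ℕ) := by
  let φ : homogeneousSubmodule (Fin m) F (i + 1) →ₗ[F] K.component θ (i + 1) :=
    ((Ideal.Quotient.mkₐ F (K.reducedIdeal θ)).toLinearMap ∘ₗ (rename b).toLinearMap).restrict
      fun r hr => ⟨rename b r, IsHomogeneous.rename_isHomogeneous hr, rfl⟩
  have hsurj : Function.Surjective ((LinearMap.range (K.mulOneForm θ w i)).mkQ ∘ₗ φ) := by
    intro y
    obtain ⟨⟨_, ⟨p, hp, rfl⟩⟩, rfl⟩ := Submodule.mkQ_surjective _ y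
    obtain ⟨r, hr, hpr⟩ := h p hp
    obtain ⟨q, hq, hpq⟩ := exists_sub_mul_oneForm_mem
      (IsHomogeneous.sub hp (IsHomogeneous.rename_isHomogeneous hr)) hpr
    refine ⟨⟨r, hr⟩, ?_⟩
    rw [LinearMap.comp_apply, eq_comm, ← sub_eq_zero, ← map_sub, ← LinearMap.mem_ker,
      Submodule.ker_mkQ]
    refine ⟨⟨_, ⟨q, hq, rfl⟩⟩, Subtype.ext ?_⟩
    have := Ideal.Quotient.eq.2 hpq
    rw [map_sub, map_mul] at this
    exact this.symm
  have := lift_rank_range_le ((LinearMap.range (K.mulOneForm θ w i)).mkQ ∘ₗ φ)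
  rw [LinearMap.range_eq_top.2 hsurj, rank_top, rank_homogeneousSubmodule_fin,
    Cardinal.lift_natCast] at this
  exact (Cardinal.lift_le_nat_iff).1 this

end PreAbstractSimplicialComplex

namespace PreAbstractSimplicialComplex

variable {α F : Type*} [Field F] {K : PreAbstractSimplicialComplex α}

/-! ### Links -/

section LinkVertex

variable (v : K.Vertex)

theorem singleton_mem_link_iff {u : α} [DecidableEq α] :
    {u} ∈ K.link v.1 ↔ v.1 ≠ u ∧ ({v.1, u} : Finset α) ∈ K := by
  have : ({u} : Finset α) ∈ K.link v.1 ↔ ({u} : Finset α).Nonempty ∧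
    ∃ h : v.1 ∉ ({u} : Finset α), ({u} : Finset α).cons v.1 h ∈ K := Iff.rfl
  simp [this, Finset.cons_eq_insert]

/-- The vertices of the link of `v` as vertices of `K`. -/
def linkVertex (u : (K.link v.1).Vertex) : K.Vertex :=
  ⟨u.1, by
    classical
    exact singleton_mem_of_mem ((singleton_mem_link_iff v).1 u.2).2 (by simp)⟩

theorem linkVertex_injective : (linkVertex v).Injective := fun _ _ h =>
  Subtype.ext (congrArg (Subtype.val : K.Vertex → α) h)

theorem linkVertex_ne (u : (K.link v.1).Vertex) : linkVertex v u ≠ v := by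
  classical
  exact fun h => ((singleton_mem_link_iff v).1 u.2).1 (congrArg Subtype.val h).symm

variable {v}

theorem X_mul_rename_mem_of_mem_faceIdeal {p : MvPolynomial (K.link v.1).Vertex F}
    (hp : p ∈ (K.link v.1).faceIdeal F) :
    X v * rename (linkVertex v) p ∈ K.faceIdeal F := by
  classical
  suffices (K.link v.1).faceIdeal F ≤
      ((K.faceIdeal F).colon {X v}).comap (rename (linkVertex v)).toRingHom by
    simpa [Submodule.mem_colon_singleton, mul_comm] using this hp
  refine Ideal.span_le.2 ?_
  rintro _ ⟨s, hs, hsK, rfl⟩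
  let t : Finset K.Vertex := s.map ⟨_, linkVertex_injective v⟩
  have hvt : v ∉ t := by
    intro h
    obtain ⟨u, -, hu⟩ := Finset.mem_map.1 h
    exact linkVertex_ne v u hu
  have ht := K.prod_X_mem_faceIdeal (F := F) (s := t.cons v hvt) (Finset.cons_nonempty _) ?_
  · rw [Finset.prod_cons, Finset.prod_map] at ht
    simpa [Submodule.mem_colon_singleton, mul_comm] using ht
  · intro h
    refine hsK ⟨hs.map, ?_, ?_⟩
    · intro hv
      obtain ⟨u, -, hu⟩ := Finset.mem_map.1 hv
      exact linkVertex_ne v u (Subtype.ext hu)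
    · convert! h
      refine Eq.trans ?_ (Finset.map_cons K.vertexEmb v t hvt).symm
      congr 1
      exact (Finset.map_map ⟨_, linkVertex_injective v⟩ K.vertexEmb s).symm

theorem X_mul_X_mem_faceIdeal_of_notMem_link {u : K.Vertex} (huv : u ≠ v)
    (hu : u ∉ Set.range (linkVertex v)) : X v * X u ∈ K.faceIdeal F := by
  classical
  refine K.X_mul_X_mem_faceIdeal huv.symm fun h => hu ?_
  exact ⟨⟨u.1, (singleton_mem_link_iff v).2 ⟨fun h => huv (Subtype.ext h.symm), h⟩⟩, rfl⟩

/-- The passage from the coefficient matrix of one-forms on `K` to that of one-forms on the link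
of `v`: the variable `x_v` is eliminated with the help of the first form. Clearing the
denominator makes this a polynomial map. -/
def linkForms {n : ℕ} (v : K.Vertex) (A : Fin (n + 2) × K.Vertex → F) :
    Fin (n + 1) × (K.link v.1).Vertex → F := fun p =>
  A (0, v) * A (p.1.succ, linkVertex v p.2) - A (p.1.succ, v) * A (0, linkVertex v p.2)

theorem generically_linkForms {n : ℕ} {P : (Fin (n + 1) × (K.link v.1).Vertex → F) → Prop}
    (hP : Generically P) : Generically fun A => P (linkForms v A) := by
  classical
  refine (hP.comp_eval (fun p : Fin (n + 1) × (K.link v.1).Vertex =>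
    (X (0, v) * X (p.1.succ, linkVertex v p.2) -
      X (p.1.succ, v) * X (0, linkVertex v p.2) : MvPolynomial (Fin (n + 2) × K.Vertex) F))
    fun b => ?_).mono fun A hA => ?_
  · -- The first form is `x_v`; the other ones are extended by zero.
    refine ⟨fun p => Fin.cases (if p.2 = v then 1 else 0)
      (fun k => Function.extend (linkVertex v) (fun u => b (k, u)) 0 p.2) p.1, fun p => ?_⟩
    simp [linkVertex_ne, (linkVertex_injective v).extend_apply]
  · unfold linkForms
    simpa using hA

end LinkVertex

variable [Finite α]

/-! ### Linear systems of parameters -/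

theorem isLSOP_of_X_mem_radical {d : ℕ} {θ : Fin d → K.Vertex → F}
    (h : ∀ v, X v ∈ (K.reducedIdeal θ).radical) : K.IsLSOP θ := by
  have hint : Algebra.IsIntegral F (K.ReducedFaceRing θ) := by
    refine ⟨fun x => ?_⟩
    obtain ⟨p, rfl⟩ := Ideal.Quotient.mk_surjective x
    induction p using MvPolynomial.induction_on with
    | C a => exact isIntegral_algebraMap (R := F) (A := K.ReducedFaceRing θ) (x := a)
    | add p q hp hq => rw [map_add]; exact hp.add hq
    | mul_X p v hp =>
      rw [map_mul]
      refine hp.mul ?_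
      obtain ⟨n, hn⟩ := h v
      refine IsIntegral.of_pow (n := n + 1) n.succ_pos ?_
      have h0 : (Ideal.Quotient.mk _ (X v ^ (n + 1)) : K.ReducedFaceRing θ) = 0 := by
        rw [Ideal.Quotient.eq_zero_iff_mem, pow_succ]
        exact Ideal.mul_mem_right _ _ hn
      rw [← map_pow, h0]
      exact isIntegral_zero
  exact Algebra.IsIntegral.finite

/-- One-forms are a linear system of parameters if their restriction to each facet is
invertible. A prime ideal containing them misses only variables of a face, and solving for the
variables of a facet around it shows that it misses none. -/
theorem isLSOP_of_det_ne_zero {d : ℕ} {θ : Fin d → K.Vertex → F}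
    (h : ∀ s : Finset α, Maximal (fun t => t ∈ K) s → ∃ g : Fin d → K.Vertex,
      g.Injective ∧ (∀ v : K.Vertex, v.1 ∈ s → v ∈ Set.range g) ∧
        (Matrix.of fun i j => θ i (g j)).det ≠ 0) : K.IsLSOP θ := by
  classical
  refine isLSOP_of_X_mem_radical fun v => ?_
  rw [Ideal.radical_eq_sInf, Ideal.mem_sInf]
  rintro P ⟨hP, hprime⟩
  by_contra hv
  let S : Finset K.Vertex := Finset.univ.filter fun u => X u ∉ P
  have hS : S.map K.vertexEmb ∈ K := by
    by_contra hS
    have := hP (Ideal.mem_sup_left (K.prod_X_mem_faceIdeal (F := F) ⟨v, by simp [S, hv]⟩ hS))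
    obtain ⟨u, hu, huP⟩ := (hprime.prod_mem_iff).1 this
    exact (Finset.mem_filter.1 hu).2 huP
  obtain ⟨s, hSs, hs⟩ := (Set.toFinite {t | t ∈ K}).exists_le_maximal hS
  obtain ⟨g, hg, hgs, hdet⟩ := h s hs
  have hout : ∀ u, u ∉ Set.range g → X u ∈ P := by
    intro u hu
    by_contra huP
    exact hu (hgs u (hSs (Finset.mem_map_of_mem _ (by simp [S, huP]))))
  have hin : ∀ j, X (g j) ∈ P := by
    refine Submodule.mem_of_det_ne_zero (P.restrictScalars F) hdet fun k => ?_
    have h1 : oneForm (θ k) ∈ P := hP (oneForm_mem_reducedIdeal k)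
    rw [oneForm_eq_sum_add_sum hg] at h1
    refine (P.add_mem_iff_left (P.sum_mem fun u hu => ?_)).1 h1
    exact (P.restrictScalars F).smul_mem _ (hout u (Finset.mem_filter.1 hu).2)
  by_cases hvg : v ∈ Set.range g
  · obtain ⟨j, rfl⟩ := hvg
    exact hv (hin j)
  · exact hv (hout v hvg)

/-- Generic one-forms are a linear system of parameters for a pure complex. The last row of the
coefficient matrix is not used. -/
theorem generically_isLSOP [Infinite F] {d : ℕ} (hK : K.IsPure d) :
    Generically fun A : Fin (d + 1) × K.Vertex → F =>
      K.IsLSOP fun (k : Fin d) v => A (k.castSucc, v) := by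
  classical
  have key : ∀ s : {s : Finset α // Maximal (fun t => t ∈ K) s}, ∃ g : Fin d → K.Vertex,
      g.Injective ∧ ∀ v : K.Vertex, v.1 ∈ s.1 → v ∈ Set.range g := by
    rintro ⟨s, hs⟩
    let e := s.equivFinOfCardEq (hK.1 s hs)
    refine ⟨fun j => ⟨(e.symm j).1, singleton_mem_of_mem hs.1 (e.symm j).2⟩,
      fun j k hjk => ?_, fun v hv => ⟨e ⟨v.1, hv⟩, Subtype.ext ?_⟩⟩
    · exact e.symm.injective (Subtype.ext (congrArg (Subtype.val : K.Vertex → α) hjk))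
    · simp
  choose g hg hgs using key
  refine (Generically.forall_of_finite fun s => generically_det_ne_zero (F := F)
    (Fin.castSucc_injective d) (hg s)).mono fun A hA => isLSOP_of_det_ne_zero fun s hs => ?_
  exact ⟨g ⟨s, hs⟩, hg _, hgs ⟨s, hs⟩, hA ⟨s, hs⟩⟩

/-! ### Good vertices -/

section Link

variable {v : K.Vertex}

/-- Modulo the annihilator of `x_v` in the face ring, a one-form only depends on its coefficients
at `v` and at the vertices of the link of `v`. -/
theorem X_mul_oneForm_sub_mem_faceIdeal (a : K.Vertex → F) :
    X v * (oneForm a - C (a v) * X v -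
      rename (linkVertex v) (oneForm fun u => a (linkVertex v u))) ∈ K.faceIdeal F := by
  classical
  have h1 : oneForm a = C (a v) * X v + (rename (linkVertex v)
      (oneForm fun u => a (linkVertex v u)) + ∑ u ∈ (Finset.univ.erase v).filter
        (fun u => u ∉ Set.range (linkVertex v)), C (a u) * X u) := by
    rw [oneForm, ← Finset.add_sum_erase _ _ (Finset.mem_univ v),
      ← Finset.sum_filter_add_sum_filter_not (Finset.univ.erase v)
        (fun u => u ∈ Set.range (linkVertex v))]
    congr 2
    simp only [oneForm, map_sum, map_mul, rename_C, rename_X]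
    rw [← Finset.sum_image (f := fun u => C (a u) * X u) (linkVertex_injective v).injOn]
    refine Finset.sum_congr ?_ fun _ _ => rfl
    ext u
    simp only [Finset.mem_filter, Finset.mem_erase, Finset.mem_univ, Finset.mem_image,
      Set.mem_range, and_true, true_and, and_iff_right_iff_imp]
    rintro ⟨u, rfl⟩
    exact linkVertex_ne v u
  rw [h1, add_sub_cancel_left, add_sub_cancel_left, Finset.mul_sum]
  refine Ideal.sum_mem _ fun u hu => ?_
  rw [Finset.mem_filter, Finset.mem_erase] at hu
  rw [mul_left_comm]
  exact Ideal.mul_mem_left _ _ (X_mul_X_mem_faceIdeal_of_notMem_link hu.1.1 hu.2)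

/-- If forms of degree `i` vanish in the quotient of the link by the forms `linkForms v A`, then
`x_v` annihilates the forms of degree `i` in the quotient of `F[K]` by the forms with coefficient
matrix `A`. The reason is that multiplication by `x_v` factors through the quotient of the face
ring of the star of `v`, which is isomorphic to the quotient for the link. -/
theorem X_mul_mem_lefschetzIdeal {n i : ℕ} {A : Fin (n + 2) × K.Vertex → F} (hA : A (0, v) ≠ 0)
    (h : ∀ p : MvPolynomial (K.link v.1).Vertex F, p.IsHomogeneous i →
      p ∈ (K.link v.1).lefschetzIdeal (fun (k : Fin n) u => linkForms v A (k.castSucc, u))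
        fun u => linkForms v A (Fin.last n, u))
    {p : MvPolynomial K.Vertex F} (hp : p.IsHomogeneous i) :
    X v * p ∈ K.lefschetzIdeal (fun (k : Fin (n + 1)) u => A (k.castSucc, u))
      fun u => A (Fin.last (n + 1), u) := by
  classical
  set J := K.lefschetzIdeal (fun (k : Fin (n + 1)) u => A (k.castSucc, u))
      fun u => A (Fin.last (n + 1), u) with hJ
  let Q : Ideal (MvPolynomial K.Vertex F) := J.colon {X v}
  have mem_Q : ∀ q, q ∈ Q ↔ X v * q ∈ J := fun q => by
    simp [Q, Submodule.mem_colon_singleton, mul_comm]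
  have hJQ : J ≤ Q := fun q hq => (mem_Q q).2 (J.mul_mem_left _ hq)
  have hrow : ∀ k : Fin (n + 2), oneForm (fun u => A (k, u)) ∈ J := by
    intro k
    induction k using Fin.lastCases with
    | last => exact oneForm_self_mem_lefschetzIdeal
    | cast k => exact oneForm_mem_lefschetzIdeal k
  -- In the quotient by `Q` a form on the link agrees with a form on `K`, up to a multiple of `x_v`.
  have hform : ∀ k : Fin (n + 2), C (A (k, v)) * X v +
      rename (linkVertex v) (oneForm fun u => A (k, linkVertex v u)) ∈ Q := by
    intro k
    have h1 := (mem_Q _).2 (faceIdeal_le_lefschetzIdeal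
      (X_mul_oneForm_sub_mem_faceIdeal (v := v) fun u => A (k, u)))
    convert Q.sub_mem (hJQ (hrow k)) h1 using 1
    ring
  have hlink : ∀ k : Fin (n + 1),
      rename (linkVertex v) (oneForm fun u => linkForms v A (k, u)) ∈ Q := by
    intro k
    convert Q.sub_mem (Q.mul_mem_left (C (A (0, v))) (hform k.succ))
      (Q.mul_mem_left (C (A (k.succ, v))) (hform 0)) using 1
    simp only [linkForms, oneForm, map_sum, map_mul, rename_C, rename_X, map_sub, sub_mul,
      Finset.sum_sub_distrib, mul_add, Finset.mul_sum]
    ring_nf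
  have hle : (K.link v.1).lefschetzIdeal (fun (k : Fin n) u => linkForms v A (k.castSucc, u))
      (fun u => linkForms v A (Fin.last n, u)) ≤ Q.comap (rename (linkVertex v)).toRingHom := by
    refine sup_le (sup_le (fun q hq => ?_) (Ideal.span_le.2 ?_)) (Ideal.span_le.2 ?_)
    · exact (mem_Q _).2 (faceIdeal_le_lefschetzIdeal (X_mul_rename_mem_of_mem_faceIdeal hq))
    · rintro _ ⟨k, rfl⟩
      exact hlink k.castSucc
    · rintro _ rfl
      exact hlink (Fin.last n)
  -- Every variable agrees modulo `Q` with a one-form in the variables of the link.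
  have hvar : ∀ u : K.Vertex, ∃ c : (K.link v.1).Vertex → F,
      X u - rename (linkVertex v) (oneForm c) ∈ Q := by
    intro u
    by_cases hu : u ∈ Set.range (linkVertex v)
    · obtain ⟨u, rfl⟩ := hu
      refine ⟨Pi.single u 1, ?_⟩
      simp [oneForm, Pi.single_apply]
    by_cases huv : u = v
    · subst huv
      refine ⟨fun t => -(A (0, u))⁻¹ * A (0, linkVertex u t), ?_⟩
      convert Q.mul_mem_left (C (A (0, u))⁻¹) (hform 0) using 1
      rw [mul_add, ← mul_assoc, ← map_mul, inv_mul_cancel₀ hA]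
      simp [oneForm, Finset.mul_sum, mul_assoc]
    · exact ⟨0, by simpa [oneForm, mem_Q] using
        faceIdeal_le_lefschetzIdeal (X_mul_X_mem_faceIdeal_of_notMem_link huv hu)⟩
  choose c hc using hvar
  let ρ : MvPolynomial K.Vertex F →ₐ[F] MvPolynomial (K.link v.1).Vertex F :=
    aeval fun u => oneForm (c u)
  have hρ : (Ideal.Quotient.mkₐ F Q).comp ((rename (linkVertex v)).comp ρ) =
      Ideal.Quotient.mkₐ F Q := by
    refine MvPolynomial.algHom_ext fun u => ?_
    simpa [ρ] using (Ideal.Quotient.eq.2 (hc u)).symm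
  have hρp : (ρ p).IsHomogeneous i := by
    simpa only [one_mul] using IsHomogeneous.aeval hp _ fun u => oneForm_isHomogeneous (c u)
  have hmem : rename (linkVertex v) (ρ p) ∈ Q := hle (h _ hρp)
  refine (mem_Q p).1 (Ideal.Quotient.eq_zero_iff_mem.1 ?_)
  rw [← Ideal.Quotient.mkₐ_eq_mk F, ← hρ]
  exact Ideal.Quotient.eq_zero_iff_mem.2 hmem

end Link

/-! ### Elimination of variables -/

section Elimination

variable {d : ℕ} {θ : Fin d → K.Vertex → F} {w : K.Vertex → F}

/-- If every variable is modulo `lefschetzIdeal` a linear combination of variables `x_{b j}` and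
of variables which multiply all forms of degree `i` into the ideal, then the cokernel of
`F(K)_i → F(K)_{i+1}` is spanned by monomials in the `x_{b j}`. -/
theorem rank_coker_le_of_X_mem {i m : ℕ} {S : Set K.Vertex}
    (hS : ∀ v ∈ S, ∀ q : MvPolynomial K.Vertex F, q.IsHomogeneous i →
      X v * q ∈ K.lefschetzIdeal θ w) (b : Fin m → K.Vertex)
    (h : ∀ u : K.Vertex, X u ∈
      (K.lefschetzIdeal θ w ⊔ Ideal.span (X '' S)).restrictScalars F ⊔
        Submodule.span F (Set.range fun j => (X (b j) : MvPolynomial K.Vertex F))) :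
    Module.rank F (K.component θ (i + 1) ⧸ LinearMap.range (K.mulOneForm θ w i)) ≤
      (numMonomials m (i + 1) : ℕ) := by
  set G := K.lefschetzIdeal θ w ⊔ Ideal.span (X '' S)
  have hvar : ∀ u : K.Vertex, ∃ c : Fin m → F, X u - rename b (oneForm c) ∈ G := by
    intro u
    obtain ⟨y, hy, z, hz, hyz⟩ := Submodule.mem_sup.1 (h u)
    obtain ⟨c, rfl⟩ := (Submodule.mem_span_range_iff_exists_fun F).1 hz
    refine ⟨c, ?_⟩
    rw [← hyz]
    simpa [oneForm, smul_eq_C_mul] using hy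
  choose c hc using hvar
  let ρ : MvPolynomial K.Vertex F →ₐ[F] MvPolynomial (Fin m) F := aeval fun u => oneForm (c u)
  have hρ : (Ideal.Quotient.mkₐ F G).comp ((rename b).comp ρ) = Ideal.Quotient.mkₐ F G := by
    refine MvPolynomial.algHom_ext fun u => ?_
    simpa [ρ] using (Ideal.Quotient.eq.2 (hc u)).symm
  refine rank_coker_le b fun p hp => ?_
  have hρp : (ρ p).IsHomogeneous (i + 1) := by
    simpa only [one_mul] using IsHomogeneous.aeval hp _ fun u => oneForm_isHomogeneous (c u)
  refine ⟨ρ p, hρp, mem_lefschetzIdeal_of_mem_sup hS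
    (hp.sub (IsHomogeneous.rename_isHomogeneous hρp)) ?_⟩
  exact Ideal.Quotient.eq.1 (DFunLike.congr_fun hρ p).symm

end Elimination

end PreAbstractSimplicialComplex

/-! ### Generic forms on a pure complex -/

namespace PreAbstractSimplicialComplex

variable {α F : Type*} [Finite α] [Field F] {K : PreAbstractSimplicialComplex α}

/-- Good vertices die in the cokernel for generic forms. -/
theorem generically_X_mul_mem_lefschetzIdeal [Infinite F] {d i : ℕ} (hd : d ≠ 0) {v : K.Vertex}
    (hv : v ∉ K.badVertices F d i) :
    Generically fun A : Fin (d + 1) × K.Vertex → F =>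
      ∀ q : MvPolynomial K.Vertex F, q.IsHomogeneous i →
        X v * q ∈ K.lefschetzIdeal (fun (k : Fin d) u => A (k.castSucc, u))
          fun u => A (Fin.last d, u) := by
  obtain ⟨n, rfl⟩ := Nat.exists_eq_succ_of_ne_zero hd
  have hsurj : (K.link v.1).ForGenericForms F n fun θ w =>
    Function.Surjective ((K.link v.1).mulOneForm θ w ((i : ℤ) - 1)) := not_not.1 hv
  have hne : Generically fun A : Fin (n + 2) × K.Vertex → F => A (0, v) ≠ 0 :=
    generically_of_eval_ne_zero (X (0, v)) ⟨1, by simp⟩ fun A hA => by simpa using hA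
  refine ((generically_linkForms hsurj).and hne).mono fun A hA q hq => ?_
  exact X_mul_mem_lefschetzIdeal hA.2 (fun p hp => mem_lefschetzIdeal_of_surjective hA.1.2 hp) hq

/-- Generic one-forms whose number is `e` eliminate `min e (#V)` of the variables in a set `V`. -/
theorem generically_exists_eliminate [Infinite F] (e : ℕ) (V : Set K.Vertex) :
    ∃ b : Fin (V.ncard - e) → K.Vertex, Generically fun A : Fin e × K.Vertex → F =>
      ∀ G : Ideal (MvPolynomial K.Vertex F), (∀ k, oneForm (fun u => A (k, u)) ∈ G) →
        (∀ v ∉ V, X v ∈ G) → ∀ u, X u ∈ G.restrictScalars F ⊔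
          Submodule.span F (Set.range fun j => (X (b j) : MvPolynomial K.Vertex F)) := by
  classical
  -- The first `min e #V` elements of `V` get eliminated, and `b` lists the elements from `e` on.
  let t : Fin V.ncard ≃ V := (Finite.equivFinOfCardEq (Nat.card_coe_set_eq V)).symm
  have hr : min V.ncard e ≤ V.ncard := min_le_left _ _
  let f : Fin (min V.ncard e) → Fin e := Fin.castLE (min_le_right _ _)
  let g : Fin (min V.ncard e) → K.Vertex := fun j => t (Fin.castLE hr j)
  let b : Fin (V.ncard - e) → K.Vertex := fun j => t ⟨j + e, by omega⟩
  have hg : g.Injective :=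
    Subtype.val_injective.comp (t.injective.comp (Fin.castLE_injective hr))
  refine ⟨b, (generically_det_ne_zero (Fin.castLE_injective (min_le_right _ _)) hg).mono
    fun A hA G hrow hV => ?_⟩
  set N := G.restrictScalars F ⊔
    Submodule.span F (Set.range fun j => (X (b j) : MvPolynomial K.Vertex F))
  have hcases : ∀ u, u ∉ Set.range g → X u ∈ N := by
    intro u hu
    by_cases huV : u ∈ V
    · obtain ⟨j, hj⟩ := t.surjective ⟨u, huV⟩
      by_cases hje : j.1 < e
      · exact absurd ⟨⟨j, lt_min j.2 hje⟩, congrArg Subtype.val hj⟩ hu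
      · refine Submodule.mem_sup_right (Submodule.subset_span ⟨⟨j - e, by omega⟩, ?_⟩)
        have : (⟨j - e + e, by omega⟩ : Fin V.ncard) = j := Fin.ext (by simp; omega)
        simp only [b, this, hj]
    · exact Submodule.mem_sup_left (hV u huV)
  have hin : ∀ j, X (g j) ∈ N := by
    refine Submodule.mem_of_det_ne_zero N hA fun k => ?_
    have h1 : oneForm (fun u => A (f k, u)) ∈ N := Submodule.mem_sup_left (hrow (f k))
    rw [oneForm_eq_sum_add_sum hg] at h1
    exact (N.add_mem_iff_left (N.sum_mem fun u hu => N.smul_mem _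
      (hcases u (Finset.mem_filter.1 hu).2))).1 h1
  intro u
  by_cases hu : u ∈ Set.range g
  · obtain ⟨j, rfl⟩ := hu
    exact hin j
  · exact hcases u hu

end PreAbstractSimplicialComplex

theorem mainTheorem12 {α F : Type*} [Finite α] [Field F] [Infinite F]
    (K : PreAbstractSimplicialComplex α) (d i : ℕ) (hK : K.IsPure d) :
    K.ForGenericForms F d fun θ w =>
      Module.rank F (K.component θ (i + 1) ⧸ LinearMap.range (K.mulOneForm θ w i)) ≤
        (numMonomials ((K.badVertices F d i).ncard - (d + 1)) (i + 1) : ℕ) := by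
  classical
  -- For `d = 0` there are no vertices, so that links are only taken when `d - 1` does not truncate.
  have hd : ∀ v : K.Vertex, d ≠ 0 := by
    intro v hd
    obtain ⟨s, hvs, hs⟩ := (Set.toFinite {t | t ∈ K}).exists_le_maximal v.2
    have hcard : s.card = 0 := (hK.1 s hs).trans hd
    rw [Finset.card_eq_zero] at hcard
    exact absurd (hvs (Finset.mem_singleton_self _)) (by simp [hcard])
  obtain ⟨b, hb⟩ := K.generically_exists_eliminate (F := F) (d + 1) (K.badVertices F d i)
  have hgood : Generically fun A : Fin (d + 1) × K.Vertex → F =>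
      ∀ v : {v // v ∉ K.badVertices F d i}, ∀ q : MvPolynomial K.Vertex F, q.IsHomogeneous i →
        X v.1 * q ∈ K.lefschetzIdeal (fun (k : Fin d) u => A (k.castSucc, u))
          fun u => A (Fin.last d, u) :=
    Generically.forall_of_finite fun v =>
      K.generically_X_mul_mem_lefschetzIdeal (hd v.1) v.2
  refine ((K.generically_isLSOP hK).and (hgood.and hb)).mono fun A hA => ⟨hA.1, ?_⟩
  refine K.rank_coker_le_of_X_mem (S := (K.badVertices F d i)ᶜ)
    (fun v hv => hA.2.1 ⟨v, hv⟩) b (hA.2.2 _ (fun k => Ideal.mem_sup_left ?_) fun v hv =>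
      Ideal.mem_sup_right (Ideal.subset_span ⟨v, hv, rfl⟩))
  induction k using Fin.lastCases with
  | last => exact PreAbstractSimplicialComplex.oneForm_self_mem_lefschetzIdeal
  | cast k => exact PreAbstractSimplicialComplex.oneForm_mem_lefschetzIdeal k
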